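/- Let $n\ge 2$, $s\in(0,1)$ and $p\in(1,\infty)$. Then there is a homeomorphism $f$ of the closed cube $[-1,1]^n$ onto itself with the following properties. 1. $f\in W^{s,p}([-1,1]^n,\mathbb R^n)$, that is, $f\in L^p([-1,1]^n,\mathbb R^n)$ and $$\int_{[-1,1]^n}\int_{[-1,1]^n}\frac{|f(x)-f(y)|^p}{|x-y|^{n+sp}}\,dy\,dx<\infty .$$ 2. $f(x)=x$ for every $x\in\partial[-1,1]^n$. 3. $f$ fails the Lusin $(N)$ condition: there is a set $N\subset(-1,1)^n$ of Lebesgue measure zero whose image $f(N)$ has positive Lebesgue (outer) measure. Moreover, $f$ can be chosen to be $\alpha$-Hölder continuous on $[-1,1]^n$ for some $\alpha\in(s,1)$, and the set $N$ in 3 can be chosen to be a Cantor set (a nonempty, compact, perfect, totally disconnected set) whose image $f(N)$ is a Cantor set as well. -/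

import Mathlib

open MeasureTheory Set
open scoped ENNReal NNReal

/-- The closed cube `[-1,1]ⁿ` in Euclidean space. -/
def closedCube (n : ℕ) : Set (EuclideanSpace ℝ (Fin n)) :=
  {x | ∀ i, x i ∈ Icc (-1 : ℝ) 1}

/-- The open cube `(-1,1)ⁿ` in Euclidean space. -/
def openCube (n : ℕ) : Set (EuclideanSpace ℝ (Fin n)) :=
  {x | ∀ i, x i ∈ Ioo (-1 : ℝ) 1}

/-- The `p`-th power of the Gagliardo seminorm,
`∫_Ω ∫_Ω |f(x) - f(y)|ᵖ / |x - y|^(n + s p) dy dx`, with values in `[0,∞]`. -/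
noncomputable def gagliardoEnergy {n m : ℕ} (s p : ℝ) (Ω : Set (EuclideanSpace ℝ (Fin n)))
    (f : EuclideanSpace ℝ (Fin n) → EuclideanSpace ℝ (Fin m)) : ℝ≥0∞ :=
  ∫⁻ x in Ω, ∫⁻ y in Ω,
    ENNReal.ofReal (‖f x - f y‖ ^ p / ‖x - y‖ ^ ((n : ℝ) + s * p))

/-- Membership in the fractional Sobolev (Sobolev–Slobodeckij) space `W^{s,p}(Ω, ℝᵐ)`, for
`0 < s < 1` and `1 ≤ p < ∞`. Only the values of `f` on `Ω` matter. -/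
def MemFracSobolev {n m : ℕ} (s p : ℝ) (Ω : Set (EuclideanSpace ℝ (Fin n)))
    (f : EuclideanSpace ℝ (Fin n) → EuclideanSpace ℝ (Fin m)) : Prop :=
  MemLp f (ENNReal.ofReal p) (volume.restrict Ω) ∧ gagliardoEnergy s p Ω f < ∞

/-- `f` restricts to a homeomorphism of `K` onto `L`. -/
def IsHomeoOn {X Y : Type*} [TopologicalSpace X] [TopologicalSpace Y]
    (f : X → Y) (K : Set X) (L : Set Y) : Prop :=
  ∃ h : K ≃ₜ L, ∀ x : K, (h x : Y) = f x

/-- Lusin's condition (N) on `Ω`: null sets are mapped to null sets. -/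
def LusinN {n : ℕ} (f : EuclideanSpace ℝ (Fin n) → EuclideanSpace ℝ (Fin n))
    (Ω : Set (EuclideanSpace ℝ (Fin n))) : Prop :=
  ∀ N ⊆ Ω, volume N = 0 → volume (f '' N) = 0

/-- A (topological) Cantor set: nonempty, compact, perfect and totally disconnected. -/
structure IsCantorSet {X : Type*} [TopologicalSpace X] (C : Set X) : Prop where
  nonempty : C.Nonempty
  isCompact : IsCompact C
  perfect : Perfect C
  isTotallyDisconnected : IsTotallyDisconnected C

/-! In one variable, let `U` be an open set that meets every interval of length ℓ ≤ 2 in measure at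
least a constant times ℓ^β, with β = 1/α, yet fills at most half of (-1, 1). The primitive of its
indicator, normalized to fix ±1, expands distances at least like ℓ^β, so its inverse g is α-Hölder.
The primitive crushes the complement of `U` to a null set, so g blows up a compact null set A to
positive measure (`exists_strictMonoOn_holder_volume_image_pos`).

The product map g × ... × g is not the identity on the boundary of the cube. Instead g acts on one
coordinate at a time, damped by a cutoff in the other coordinates (`coordMap`). Each factor is an
α-Hölder bijection of the cube, and the composition of all n factors is α^n-Hölder and agrees with
the product map on Aⁿ. Taking α^n > s gives the Sobolev bound by
`gagliardoEnergy_lt_top_of_holderOnWith`. The Cantor set is the perfect part of Aⁿ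
(`exists_isCantorSet_subset`). -/

/-! ### A quantitatively dense open set of small measure -/

/-- The union, over all dyadic rationals `j / 2 ^ k`, of the intervals of length
`c * (2 ^ (-k)) ^ β` starting at `j / 2 ^ k`. -/
def dyadicOpen (c β : ℝ) : Set ℝ :=
  ⋃ (k : ℕ) (j : ℤ), Ioo (j * (1 / 2 : ℝ) ^ k) (j * (1 / 2 : ℝ) ^ k + c * ((1 / 2 : ℝ) ^ k) ^ β)

theorem isOpen_dyadicOpen (c β : ℝ) : IsOpen (dyadicOpen c β) :=
  isOpen_iUnion fun _ => isOpen_iUnion fun _ => isOpen_Ioo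

theorem half_pow_rpow_le {β : ℝ} (hβ : 1 ≤ β) (k : ℕ) :
    ((1 / 2 : ℝ) ^ k) ^ β ≤ (1 / 2 : ℝ) ^ k := by
  have h := Real.rpow_le_rpow_of_exponent_ge (x := (1 / 2 : ℝ) ^ k) (by positivity)
    (pow_le_one₀ (by norm_num) (by norm_num)) hβ
  simpa using h

theorem le_volume_dyadicOpen_inter_Ioc {c β : ℝ} (hc0 : 0 ≤ c) (hc1 : c ≤ 1) (hβ : 1 ≤ β)
    {x y : ℝ} (hxy : x < y) (hyx : y ≤ x + 2) :
    ENNReal.ofReal (c * ((y - x) / 4) ^ β) ≤ volume (dyadicOpen c β ∩ Ioc x y) := by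
  -- With δ = 2^(-n-1) this gives 2δ < y - x ≤ 4δ. The first multiple of δ after x lies before x +
  -- δ, so the interval of length at most δ starting there still ends before y.
  obtain ⟨n, hn1, hn2⟩ := exists_nat_pow_near_of_lt_one (x := (y - x) / 2) (y := (1 / 2 : ℝ))
    (by linarith) (by linarith) (by norm_num) (by norm_num)
  set δ : ℝ := (1 / 2 : ℝ) ^ (n + 1) with hδ
  have hδn : (1 / 2 : ℝ) ^ n = 2 * δ := by rw [hδ, pow_succ]; ring
  have hδ0 : 0 < δ := by positivity
  have hw : c * δ ^ β ≤ δ := by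
    have h := half_pow_rpow_le hβ (n + 1)
    have h0 : 0 ≤ δ ^ β := by positivity
    rw [← hδ] at h
    nlinarith
  set j : ℤ := ⌈x / δ⌉ with hj
  have hj1 : x ≤ j * δ := (div_le_iff₀ hδ0).1 (Int.le_ceil _)
  have hj2 : j * δ < x + δ := by
    have := Int.ceil_lt_add_one (x / δ)
    rw [← hj] at this
    calc (j : ℝ) * δ < (x / δ + 1) * δ := by gcongr
      _ = x + δ := by field_simp
  have hsub : Ioo (j * δ) (j * δ + c * δ ^ β) ⊆ dyadicOpen c β ∩ Ioc x y := by
    refine subset_inter (subset_iUnion₂_of_subset (n + 1) j subset_rfl) ?_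
    intro t ht
    exact ⟨by linarith [ht.1], by linarith [ht.2]⟩
  refine le_trans ?_ (measure_mono hsub)
  rw [Real.volume_Ioo, add_sub_cancel_left]
  refine ENNReal.ofReal_le_ofReal ?_
  gcongr
  linarith

theorem volume_dyadicOpen_inter_Ioo_le {c β : ℝ} (hc0 : 0 ≤ c) (hc1 : c ≤ 1) (hβ : 1 < β) :
    volume (dyadicOpen c β ∩ Ioo (-1) 1) ≤
      ENNReal.ofReal (2 * c / (1 - 2 * (1 / 2 : ℝ) ^ β)) := by
  have hθ : (1 / 2 : ℝ) ^ β < 1 / 2 := by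
    simpa using Real.rpow_lt_rpow_of_exponent_gt (x := (1 / 2 : ℝ)) (by norm_num) (by norm_num) hβ
  have hθ0 : 0 < (1 / 2 : ℝ) ^ β := by positivity
  set θ : ℝ := (1 / 2 : ℝ) ^ β with hθd
  have hpow : ∀ k : ℕ, ((1 / 2 : ℝ) ^ k) ^ β = θ ^ k := fun k => by
    rw [hθd, ← Real.rpow_natCast, ← Real.rpow_mul (by norm_num), mul_comm, Real.rpow_mul (by norm_num),
      Real.rpow_natCast]
  -- An interval of generation k has length at most 2^(-k), so those starting at -1 - 2^(-k) or
  -- earlier end by -1. At most 2 · 2^k starting points remain.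
  have hsub : dyadicOpen c β ∩ Ioo (-1) 1 ⊆
      ⋃ k : ℕ, ⋃ j ∈ Finset.Ico (-(2 : ℤ) ^ k) ((2 : ℤ) ^ k),
        Ioo (j * (1 / 2 : ℝ) ^ k) (j * (1 / 2 : ℝ) ^ k + c * θ ^ k) := by
    rintro t ⟨ht, ht1, ht2⟩
    simp only [dyadicOpen, mem_iUnion] at ht
    obtain ⟨k, j, hkj⟩ := ht
    have hwk : c * ((1 / 2 : ℝ) ^ k) ^ β ≤ (1 / 2 : ℝ) ^ k := by
      have h := half_pow_rpow_le hβ.le k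
      have h0 : 0 ≤ ((1 / 2 : ℝ) ^ k) ^ β := by positivity
      nlinarith
    have h2 : (2 : ℝ) ^ k * (1 / 2 : ℝ) ^ k = 1 := by rw [← mul_pow]; norm_num
    have h20 : (0 : ℝ) < (1 / 2 : ℝ) ^ k := by positivity
    simp only [mem_iUnion]
    refine ⟨k, j, ?_, by rw [← hpow]; exact hkj⟩
    rw [Finset.mem_Ico]
    constructor
    · have : (-(2 : ℝ) ^ k) < j + 1 := by
        by_contra! hcon
        have := mul_le_mul_of_nonneg_right hcon h20.le
        nlinarith [hkj.2]
      have : (-(2 : ℤ) ^ k) < j + 1 := by exact_mod_cast this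
      omega
    · have : (j : ℝ) < (2 : ℝ) ^ k := by
        by_contra! hcon
        have := mul_le_mul_of_nonneg_right hcon h20.le
        nlinarith [hkj.1]
      exact_mod_cast this
  calc volume (dyadicOpen c β ∩ Ioo (-1) 1)
      ≤ ∑' k : ℕ, volume (⋃ j ∈ Finset.Ico (-(2 : ℤ) ^ k) ((2 : ℤ) ^ k),
        Ioo (j * (1 / 2 : ℝ) ^ k) (j * (1 / 2 : ℝ) ^ k + c * θ ^ k)) :=
        (measure_mono hsub).trans (measure_iUnion_le _)
    _ ≤ ∑' k : ℕ, ENNReal.ofReal (2 * c * (2 * θ) ^ k) := by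
        refine ENNReal.tsum_le_tsum fun k => ?_
        refine (measure_biUnion_finset_le _ _).trans ?_
        simp only [Real.volume_Ioo, add_sub_cancel_left, Finset.sum_const, Int.card_Ico]
        have hcard : ((2 : ℤ) ^ k - -(2 : ℤ) ^ k).toNat = 2 * 2 ^ k := by
          have : (2 : ℤ) ^ k - -(2 : ℤ) ^ k = ((2 * 2 ^ k : ℕ) : ℤ) := by push_cast; ring
          rw [this, Int.toNat_natCast]
        rw [hcard, nsmul_eq_mul, ← ENNReal.ofReal_natCast, ← ENNReal.ofReal_mul (by positivity)]
        refine ENNReal.ofReal_le_ofReal (le_of_eq ?_)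
        push_cast
        rw [mul_pow]
        ring
    _ = ENNReal.ofReal (2 * c / (1 - 2 * θ)) := by
        have hs : Summable fun k : ℕ => 2 * c * (2 * θ) ^ k :=
          (summable_geometric_of_lt_one (by positivity) (by linarith)).mul_left _
        rw [← ENNReal.ofReal_tsum_of_nonneg (fun k => by positivity) hs, tsum_mul_left,
          tsum_geometric_of_lt_one (by positivity) (by linarith), div_eq_mul_inv]

/-- An open set that is quantitatively dense, yet fills at most half of `(-1, 1)`. -/
theorem exists_isOpen_le_volume_inter_Ioc {β : ℝ} (hβ : 1 < β) :
    ∃ (U : Set ℝ) (c : ℝ), IsOpen U ∧ 0 < c ∧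
      (∀ x y, x < y → y ≤ x + 2 → ENNReal.ofReal (c * (y - x) ^ β) ≤ volume (U ∩ Ioc x y)) ∧
      volume (U ∩ Ioo (-1) 1) ≤ 1 := by
  have hθ : (1 / 2 : ℝ) ^ β < 1 / 2 := by
    simpa using Real.rpow_lt_rpow_of_exponent_gt (x := (1 / 2 : ℝ)) (by norm_num) (by norm_num) hβ
  have hθ0 : 0 < (1 / 2 : ℝ) ^ β := by positivity
  -- Chosen so that the geometric series bounding the measure sums to exactly 1.
  set c : ℝ := (1 - 2 * (1 / 2 : ℝ) ^ β) / 2 with hc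
  have hc0 : 0 < c := by rw [hc]; linarith
  have hc1 : c ≤ 1 := by rw [hc]; linarith
  refine ⟨dyadicOpen c β, c * (1 / 4) ^ β, isOpen_dyadicOpen c β, by positivity, ?_, ?_⟩
  · intro x y hxy hyx
    have h := le_volume_dyadicOpen_inter_Ioc hc0.le hc1 hβ.le hxy hyx
    rwa [div_eq_mul_one_div, mul_comm (y - x), Real.mul_rpow (by norm_num) (by linarith),
      ← mul_assoc] at h
  · refine (volume_dyadicOpen_inter_Ioo_le hc0.le hc1 hβ).trans (le_of_eq ?_)
    rw [show 2 * c / (1 - 2 * (1 / 2 : ℝ) ^ β) = 1 by rw [hc]; field_simp; exact div_self (by linarith),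
      ENNReal.ofReal_one]

/-! ### The Hölder homeomorphism of the interval -/

/-- The signed length of the part of `U` between `0` and `x`. -/
noncomputable def cumVolume (U : Set ℝ) (x : ℝ) : ℝ :=
  ∫ t in (0 : ℝ)..x, U.indicator (fun _ => (1 : ℝ)) t

theorem intervalIntegrable_indicator_one {U : Set ℝ} (hU : MeasurableSet U) (x y : ℝ) :
    IntervalIntegrable (U.indicator fun _ => (1 : ℝ)) volume x y := by
  rw [intervalIntegrable_iff]
  exact (integrableOn_const (by simp)).indicator hU

theorem cumVolume_sub {U : Set ℝ} (hU : MeasurableSet U) {x y : ℝ} (hxy : x ≤ y) :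
    cumVolume U y - cumVolume U x = volume.real (U ∩ Ioc x y) := by
  rw [cumVolume, cumVolume, intervalIntegral.integral_interval_sub_left
    (intervalIntegrable_indicator_one hU _ _) (intervalIntegrable_indicator_one hU _ _),
    intervalIntegral.integral_of_le hxy, integral_indicator hU, setIntegral_const,
    measureReal_restrict_apply hU, smul_eq_mul, mul_one]

theorem continuous_cumVolume {U : Set ℝ} (hU : MeasurableSet U) : Continuous (cumVolume U) :=
  intervalIntegral.continuous_primitive (intervalIntegrable_indicator_one hU) 0

theorem volume_inter_Ioc_ne_top (U : Set ℝ) (x y : ℝ) : volume (U ∩ Ioc x y) ≠ ∞ :=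
  ((measure_mono inter_subset_right).trans_lt (measure_Ioc_lt_top (a := x) (b := y))).ne

theorem strictMono_cumVolume {U : Set ℝ} (hU : MeasurableSet U)
    (hpos : ∀ x y, x < y → 0 < volume (U ∩ Ioc x y)) : StrictMono (cumVolume U) := by
  intro x y hxy
  rw [← sub_pos, cumVolume_sub hU hxy.le]
  exact ENNReal.toReal_pos (hpos x y hxy).ne' (volume_inter_Ioc_ne_top U x y)

theorem image_Ioc_of_strictMono {h : ℝ → ℝ} (hm : StrictMono h) (hc : Continuous h) {a b : ℝ}
    (hab : a ≤ b) : h '' Ioc a b = Ioc (h a) (h b) := by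
  refine Subset.antisymm ?_ (intermediate_value_Ioc hab hc.continuousOn)
  rintro _ ⟨x, hx, rfl⟩
  exact ⟨hm hx.1, hm.monotone hx.2⟩

/-- Pulling Lebesgue measure back along the primitive gives Lebesgue measure restricted to `U`, as a
check on half-open intervals shows; `E` misses `U`. -/
theorem volume_image_cumVolume_eq_zero {U E : Set ℝ} (hU : MeasurableSet U)
    (hm : StrictMono (cumVolume U)) (hE : MeasurableSet E) (hUE : Disjoint E U) :
    volume (cumVolume U '' E) = 0 := by
  have hemb : MeasurableEmbedding (cumVolume U) :=
    (continuous_cumVolume hU).measurableEmbedding hm.injective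
  have key : volume.restrict U = volume.comap (cumVolume U) := by
    refine Measure.ext_of_Ioc _ _ fun a b hab => ?_
    rw [hemb.comap_apply, image_Ioc_of_strictMono hm (continuous_cumVolume hU) hab.le,
      Real.volume_Ioc, cumVolume_sub hU hab.le, Measure.restrict_apply measurableSet_Ioc,
      inter_comm, measureReal_def, ENNReal.ofReal_toReal (volume_inter_Ioc_ne_top U a b)]
  rw [← hemb.comap_apply, ← key, Measure.restrict_apply hE, hUE.inter_eq, measure_empty]

/-- For every `α < 1` there is an increasing `α`-Hölder homeomorphism of `[-1, 1]` that maps some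
compact null set onto a set of positive measure. -/
theorem exists_strictMonoOn_holder_volume_image_pos {α : ℝ} (h0 : 0 < α) (h1 : α < 1) :
    ∃ g : ℝ → ℝ, StrictMonoOn g (Icc (-1) 1) ∧ g (-1) = -1 ∧ g 1 = 1 ∧
      (∃ K : ℝ, 0 ≤ K ∧ ∀ x ∈ Icc (-1 : ℝ) 1, ∀ y ∈ Icc (-1 : ℝ) 1,
        |g x - g y| ≤ K * |x - y| ^ α) ∧
      ∃ A ⊆ Ioo (-1 : ℝ) 1, IsCompact A ∧ volume A = 0 ∧ 0 < volume (g '' A) := by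
  obtain ⟨U, c, hUo, hc, hlow, hup⟩ := exists_isOpen_le_volume_inter_Ioc (one_lt_inv_iff₀.2 ⟨h0, h1⟩)
  have hU := hUo.measurableSet
  have hpos : ∀ x y, x < y → 0 < volume (U ∩ Ioc x y) := by
    intro x y hxy
    -- The lower bound `hlow` covers only lengths up to 2, hence the truncation.
    have hxm : x < min y (x + 2) := lt_min hxy (by linarith)
    refine lt_of_lt_of_le ?_ ((hlow x (min y (x + 2)) hxm (min_le_right _ _)).trans
      (measure_mono (inter_subset_inter_right _ (Ioc_subset_Ioc_right (min_le_left _ _)))))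
    have : 0 < min y (x + 2) - x := sub_pos.2 hxm
    exact ENNReal.ofReal_pos.2 (by positivity)
  have hm := strictMono_cumVolume hU hpos
  have hcont := continuous_cumVolume hU
  set H := cumVolume U with hH
  have hd : 0 < H 1 - H (-1) := sub_pos.2 (hm (by norm_num))
  set a : ℝ := 2 / (H 1 - H (-1)) with ha
  have ha0 : 0 < a := by positivity
  set h : ℝ → ℝ := fun x => a * (H x - H (-1)) - 1 with hh
  have hhm : StrictMono h := fun x y hxy => by
    have := hm hxy
    simp only [hh]
    gcongr
  have hhc : Continuous h := by fun_prop
  have hhn1 : h (-1) = -1 := by simp [hh]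
  have hh1 : h 1 = 1 := by
    simp only [hh, ha]
    rw [div_mul_cancel₀ _ hd.ne']
    norm_num
  have hsurj : SurjOn h (Icc (-1) 1) (Icc (-1) 1) := by
    have := intermediate_value_Icc (by norm_num : (-1 : ℝ) ≤ 1) hhc.continuousOn
    rwa [hhn1, hh1] at this
  set g : ℝ → ℝ := Function.invFunOn h (Icc (-1) 1) with hg
  have hgmem : ∀ y ∈ Icc (-1 : ℝ) 1, g y ∈ Icc (-1 : ℝ) 1 := fun y hy =>
    Function.invFunOn_mem (hsurj hy)
  have hhg : ∀ y ∈ Icc (-1 : ℝ) 1, h (g y) = y := fun y hy => Function.invFunOn_eq (hsurj hy)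
  have hmaps : ∀ x ∈ Icc (-1 : ℝ) 1, h x ∈ Icc (-1 : ℝ) 1 := fun x hx =>
    ⟨hhn1 ▸ hhm.monotone hx.1, hh1 ▸ hhm.monotone hx.2⟩
  have hgh : ∀ x ∈ Icc (-1 : ℝ) 1, g (h x) = x := fun x hx =>
    hhm.injective (hhg _ (hmaps x hx))
  have hexp : ∀ x y, x ≤ y → y ≤ x + 2 → a * c * (y - x) ^ α⁻¹ ≤ h y - h x := by
    intro x y hxy hyx
    rcases hxy.eq_or_lt with rfl | hlt
    · simp [Real.zero_rpow (inv_pos.2 h0).ne']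
    · have := hlow x y hlt hyx
      rw [ENNReal.ofReal_le_iff_le_toReal (volume_inter_Ioc_ne_top U x y)] at this
      rw [show h y - h x = a * (H y - H x) by simp only [hh]; ring, cumVolume_sub hU hxy, mul_assoc]
      exact mul_le_mul_of_nonneg_left this ha0.le
  have hgm : StrictMonoOn g (Icc (-1) 1) := fun x hx y hy hxy => by
    rwa [← hhm.lt_iff_lt, hhg x hx, hhg y hy]
  have hhol : ∀ x ∈ Icc (-1 : ℝ) 1, ∀ y ∈ Icc (-1 : ℝ) 1, x ≤ y →
      |g x - g y| ≤ ((a * c)⁻¹) ^ α * |x - y| ^ α := by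
    intro x hx y hy hxy
    have hgxy := hgm.monotoneOn hx hy hxy
    have h2 := hexp (g x) (g y) hgxy (by linarith [(hgmem x hx).1, (hgmem y hy).2])
    rw [hhg x hx, hhg y hy] at h2
    rw [abs_sub_comm, abs_of_nonneg (sub_nonneg.2 hgxy), abs_sub_comm x y,
      abs_of_nonneg (sub_nonneg.2 hxy), ← Real.mul_rpow (by positivity) (sub_nonneg.2 hxy)]
    have h3 : (g y - g x) ^ α⁻¹ ≤ (a * c)⁻¹ * (y - x) := by
      rw [inv_mul_eq_div, le_div_iff₀ (by positivity), mul_comm]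
      exact h2
    calc g y - g x = ((g y - g x) ^ α⁻¹) ^ α := (Real.rpow_inv_rpow (sub_nonneg.2 hgxy) h0.ne').symm
      _ ≤ _ := Real.rpow_le_rpow (Real.rpow_nonneg (sub_nonneg.2 hgxy) _) h3 h0.le
  -- The length 3/2 exceeds the measure 1 that `U` can remove, and the endpoints stay inside (-1,
  -- 1).
  set F : Set ℝ := Icc (-3 / 4) (3 / 4) \ U with hF
  have hFc : IsCompact F := isCompact_Icc.diff hUo
  have hFsub : F ⊆ Ioo (-1) 1 := fun x hx => ⟨by linarith [hx.1.1], by linarith [hx.1.2]⟩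
  have hgF : g '' (h '' F) = F := by
    rw [image_image]
    exact (image_congr fun x hx => hgh x (Ioo_subset_Icc_self (hFsub hx))).trans (image_id' F)
  refine ⟨g, hgm, ?_, ?_, ⟨((a * c)⁻¹) ^ α, by positivity, ?_⟩, h '' F, ?_, hFc.image hhc, ?_, ?_⟩
  · conv_lhs => rw [← hhn1]
    exact hgh _ (by norm_num)
  · conv_lhs => rw [← hh1]
    exact hgh _ (by norm_num)
  · intro x hx y hy
    rcases le_total x y with hxy | hxy
    · exact hhol x hx y hy hxy
    · rw [abs_sub_comm, abs_sub_comm x]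
      exact hhol y hy x hx hxy
  · rintro _ ⟨x, hx, rfl⟩
    exact ⟨hhn1 ▸ hhm (hFsub hx).1, hh1 ▸ hhm (hFsub hx).2⟩
  · have hz := volume_image_cumVolume_eq_zero hU hm hFc.measurableSet disjoint_sdiff_left
    have himg : h '' F = (fun x => x + (-(a * H (-1)) - 1)) '' ((fun x => a * x) '' (H '' F)) := by
      simp only [image_image, hh]
      exact image_congr fun x _ => by ring
    rw [himg, image_add_right, measure_preimage_add_right]
    exact (Measure.addHaar_smul volume a (H '' F)).trans (by rw [hz, mul_zero])
  · rw [hgF]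
    have hle : volume (Icc (-3 / 4 : ℝ) (3 / 4)) ≤ volume F + volume (U ∩ Ioo (-1) 1) := by
      refine (measure_mono ?_).trans (measure_union_le _ _)
      intro x hx
      by_cases hxU : x ∈ U
      · exact Or.inr ⟨hxU, by linarith [hx.1], by linarith [hx.2]⟩
      · exact Or.inl ⟨hx, hxU⟩
    by_contra hcon
    rw [not_lt, nonpos_iff_eq_zero] at hcon
    rw [hcon, zero_add, Real.volume_Icc] at hle
    have := hle.trans hup
    rw [← ENNReal.ofReal_one, ENNReal.ofReal_le_ofReal_iff zero_le_one] at this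
    norm_num at this

/-! ### Cantor sets and powers of linear sets -/

theorem isHomeoOn_of_bijOn {X Y : Type*} [TopologicalSpace X] [TopologicalSpace Y] [T2Space Y]
    {f : X → Y} {K : Set X} {L : Set Y} (hK : IsCompact K) (hf : ContinuousOn f K)
    (hb : BijOn f K L) : IsHomeoOn f K L := by
  have : CompactSpace K := isCompact_iff_compactSpace.1 hK
  have hc : Continuous (hb.equiv f) := by
    refine Continuous.subtype_mk (f := fun x : K => f x) ?_ _
    exact continuousOn_iff_continuous_domRestrict.1 hf
  exact ⟨hc.homeoOfEquivCompactToT2, fun x => rfl⟩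

theorem IsCantorSet.image {X Y : Type*} [TopologicalSpace X] [TopologicalSpace Y] [T2Space Y]
    {f : X → Y} {C : Set X} (hC : IsCantorSet C) (hf : ContinuousOn f C) (hi : InjOn f C) :
    IsCantorSet (f '' C) := by
  refine ⟨hC.nonempty.image f, hC.isCompact.image_of_continuousOn hf,
    ⟨(hC.isCompact.image_of_continuousOn hf).isClosed, ?_⟩, ?_⟩
  · rintro _ ⟨x, hx, rfl⟩
    have h := hC.perfect.acc x hx
    rw [accPt_iff_nhds] at h ⊢
    intro V hV
    obtain ⟨W, hW, hWV⟩ := mem_nhdsWithin_iff_exists_mem_nhds_inter.1 (hf x hx hV)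
    obtain ⟨y, ⟨hyW, hyC⟩, hyx⟩ := h W hW
    exact ⟨f y, ⟨hWV ⟨hyW, hyC⟩, mem_image_of_mem f hyC⟩, fun h => hyx (hi hyC hx h)⟩
  · have : CompactSpace C := isCompact_iff_compactSpace.1 hC.isCompact
    have hemb : Topology.IsEmbedding (fun x : C => f x) :=
      (Continuous.isClosedEmbedding (continuousOn_iff_continuous_domRestrict.1 hf)
        (injOn_iff_injective.1 hi)).isEmbedding
    have h := hemb.isTotallyDisconnected_range.2
      (totallyDisconnectedSpace_subtype_iff.2 hC.isTotallyDisconnected)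
    rwa [show range (fun x : C => f x) = f '' C by rw [image_eq_range]] at h

/-- A preconnected set with two points contains a nondegenerate interval, which has positive length.
-/
theorem isTotallyDisconnected_of_volume_eq_zero {A : Set ℝ} (hA : volume A = 0) :
    IsTotallyDisconnected A := by
  intro t htA ht x hx y hy
  by_contra hne
  wlog hxy : x < y generalizing x y
  · exact this hy hx (Ne.symm hne) (lt_of_le_of_ne (not_lt.1 hxy) (Ne.symm hne))
  have := measure_mono_null ((ht.ordConnected.out hx hy).trans htA) hA
  rw [Real.volume_Icc, ENNReal.ofReal_eq_zero] at this
  linarith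

/-- The power `A ^ n` of a set of real numbers, as a subset of Euclidean space. -/
def euclideanPower (n : ℕ) (A : Set ℝ) : Set (EuclideanSpace ℝ (Fin n)) :=
  {x | ∀ i, x i ∈ A}

theorem euclideanPower_eq_preimage (n : ℕ) (A : Set ℝ) :
    euclideanPower n A = (WithLp.ofLp (p := 2) (V := Fin n → ℝ)) ⁻¹' univ.pi fun _ => A := by
  ext x
  simp [euclideanPower]

theorem isCompact_euclideanPower (n : ℕ) {A : Set ℝ} (hA : IsCompact A) :
    IsCompact (euclideanPower n A) := by
  rw [euclideanPower_eq_preimage]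
  exact (PiLp.homeomorph 2 fun _ : Fin n => ℝ).isCompact_preimage.2 (isCompact_univ_pi fun _ => hA)

theorem volume_euclideanPower (n : ℕ) {A : Set ℝ} (hA : MeasurableSet A) :
    volume (euclideanPower n A) = volume A ^ n := by
  rw [euclideanPower_eq_preimage, (PiLp.volume_preserving_ofLp (Fin n)).measure_preimage
    (MeasurableSet.univ_pi fun _ => hA).nullMeasurableSet, volume_pi_pi]
  simp

theorem isTotallyDisconnected_euclideanPower (n : ℕ) {A : Set ℝ} (hA : IsTotallyDisconnected A) :
    IsTotallyDisconnected (euclideanPower n A) := by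
  intro t htA ht x hx y hy
  ext i
  have hc : Continuous fun z : EuclideanSpace ℝ (Fin n) => z i := by fun_prop
  refine hA ((fun z : EuclideanSpace ℝ (Fin n) => z i) '' t) ?_ (ht.image _ hc.continuousOn)
    (mem_image_of_mem _ hx) (mem_image_of_mem _ hy)
  rintro _ ⟨z, hz, rfl⟩
  exact htA hz i

theorem isCompact_closedCube (n : ℕ) : IsCompact (closedCube n) :=
  isCompact_euclideanPower n isCompact_Icc

theorem exists_abs_eq_one_of_mem_frontier {n : ℕ} {x : EuclideanSpace ℝ (Fin n)}
    (hx : x ∈ frontier (closedCube n)) : ∃ j, |x j| = 1 := by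
  have hmem : x ∈ closedCube n := (isCompact_closedCube n).isClosed.frontier_subset hx
  by_contra! hcon
  have hopen : IsOpen (openCube n) := by
    simp only [openCube, ofPred_forall]
    refine isOpen_iInter_of_finite fun i => ?_
    have hc : Continuous fun z : EuclideanSpace ℝ (Fin n) => z i := by fun_prop
    exact isOpen_Ioo.preimage hc
  have hsub : openCube n ⊆ closedCube n := fun y hy i => Ioo_subset_Icc_self (hy i)
  have hxo : x ∈ openCube n := fun i => by
    have h1 : |x i| < 1 := lt_of_le_of_ne (abs_le.2 (hmem i)) (hcon i)
    exact abs_lt.1 h1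
  exact hx.2 (interior_maximal hsub hopen hxo)

/-- By Cantor–Bendixson, `A` is a countable set together with a perfect one; the countable part has
a countable, hence null, image. -/
theorem exists_isCantorSet_subset {n : ℕ} {A : Set (EuclideanSpace ℝ (Fin n))} (hn : n ≠ 0)
    {f : EuclideanSpace ℝ (Fin n) → EuclideanSpace ℝ (Fin n)} (hA : IsCompact A)
    (hd : IsTotallyDisconnected A) (hf : 0 < volume (f '' A)) :
    ∃ C ⊆ A, IsCantorSet C ∧ 0 < volume (f '' C) := by
  obtain ⟨V, D, hV, hD, rfl⟩ := exists_countable_union_perfect_of_isClosed hA.isClosed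
  have : NeZero n := ⟨hn⟩
  have hpos : 0 < volume (f '' D) := by
    refine lt_of_lt_of_le hf ?_
    rw [image_union]
    refine (measure_union_le _ _).trans ?_
    rw [(hV.image f).measure_zero, zero_add]
  refine ⟨D, subset_union_right, ⟨?_, hA.of_isClosed_subset hD.closed subset_union_right, hD,
    fun t ht => hd t (ht.trans subset_union_right)⟩, hpos⟩
  rw [nonempty_iff_ne_empty]
  rintro rfl
  simp at hpos

/-! ### Hölder maps have finite Gagliardo energy -/

/-- In polar coordinates the radial integrand is t^(n-1) · t^(ε-n) = t^(ε-1). -/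
theorem lintegral_ball_norm_rpow_lt_top {n : ℕ} (hn : n ≠ 0) {ε : ℝ} (hε : 0 < ε) (R : ℝ) :
    ∫⁻ z in Metric.ball (0 : EuclideanSpace ℝ (Fin n)) R,
      ENNReal.ofReal (‖z‖ ^ (ε - n)) < ∞ := by
  have : NeZero n := ⟨hn⟩
  have h : IntegrableOn (fun z : EuclideanSpace ℝ (Fin n) => ‖z‖ ^ (ε - n)) (Metric.ball 0 R) := by
    rw [integrableOn_fun_norm_addHaar volume (f := fun t : ℝ => t ^ (ε - n))]
    have h1 : IntegrableOn (fun t : ℝ => t ^ (ε - 1)) (Ioo 0 R) :=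
      (intervalIntegral.intervalIntegrable_rpow' (a := 0) (b := R) (by linarith)).1.mono_set
        Ioo_subset_Ioc_self
    refine h1.congr_fun (fun t ht => ?_) measurableSet_Ioo
    have hn1 : 1 ≤ n := Nat.one_le_iff_ne_zero.2 hn
    simp only [finrank_euclideanSpace, Fintype.card_fin, smul_eq_mul]
    rw [← Real.rpow_natCast, ← Real.rpow_add ht.1, Nat.cast_sub hn1]
    congr 1
    push_cast
    ring
  have := h.lintegral_lt_top
  simpa using this

/-- The Hölder bound dominates the integrand by K^p |x - y|^(ε-n) with ε = (α - s)p > 0. Translation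
invariance makes the bound on the inner integral independent of x. -/
theorem gagliardoEnergy_lt_top_of_holderOnWith {n m : ℕ} (hn : n ≠ 0) {s p : ℝ} (hp : 0 < p)
    {Ω : Set (EuclideanSpace ℝ (Fin n))} (hΩ : IsCompact Ω)
    {f : EuclideanSpace ℝ (Fin n) → EuclideanSpace ℝ (Fin m)} {K α : ℝ≥0} (hα : s < α)
    (hf : HolderOnWith K α f Ω) : gagliardoEnergy s p Ω f < ∞ := by
  obtain ⟨R, hR⟩ := hΩ.isBounded.subset_ball 0
  set ε : ℝ := (α - s) * p with hε
  have hε0 : 0 < ε := mul_pos (sub_pos.2 hα) hp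
  set φ : EuclideanSpace ℝ (Fin n) → ℝ≥0∞ :=
    (Metric.ball 0 (R + R)).indicator fun z => ENNReal.ofReal (‖z‖ ^ (ε - n)) with hφ
  set I : ℝ≥0∞ := ∫⁻ z, φ z with hI
  have hIfin : I < ∞ := by
    rw [hI, hφ, lintegral_indicator measurableSet_ball]
    exact lintegral_ball_norm_rpow_lt_top hn hε0 _
  have hinner : ∀ x ∈ Ω, ∫⁻ y in Ω,
      ENNReal.ofReal (‖f x - f y‖ ^ p / ‖x - y‖ ^ ((n : ℝ) + s * p)) ≤
        ENNReal.ofReal ((K : ℝ) ^ p) * I := by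
    intro x hx
    calc ∫⁻ y in Ω, ENNReal.ofReal (‖f x - f y‖ ^ p / ‖x - y‖ ^ ((n : ℝ) + s * p))
        ≤ ∫⁻ y in Ω, ENNReal.ofReal ((K : ℝ) ^ p) * φ (x - y) := by
          refine setLIntegral_mono' hΩ.measurableSet fun y hy => ?_
          have hmem : x - y ∈ Metric.ball (0 : EuclideanSpace ℝ (Fin n)) (R + R) := by
            have h1 := hR hx
            have h2 := hR hy
            rw [mem_ball_zero_iff] at h1 h2 ⊢
            exact (norm_sub_le _ _).trans_lt (add_lt_add h1 h2)
          rw [hφ, indicator_of_mem hmem, ← ENNReal.ofReal_mul (by positivity)]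
          refine ENNReal.ofReal_le_ofReal ?_
          rcases eq_or_ne x y with rfl | hxy
          · rw [sub_self, norm_zero, Real.zero_rpow hp.ne', zero_div]
            positivity
          · have hd : 0 < ‖x - y‖ := norm_pos_iff.2 (sub_ne_zero.2 hxy)
            have h := hf.dist_le hx hy
            rw [dist_eq_norm, dist_eq_norm] at h
            rw [div_le_iff₀ (by positivity), mul_assoc, ← Real.rpow_add hd]
            calc ‖f x - f y‖ ^ p ≤ (K * ‖x - y‖ ^ (α : ℝ)) ^ p := by gcongr
              _ = K ^ p * ‖x - y‖ ^ (α * p) := by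
                rw [Real.mul_rpow (by positivity) (by positivity), ← Real.rpow_mul hd.le]
              _ = _ := by congr 2; rw [hε]; ring
      _ ≤ ∫⁻ y, ENNReal.ofReal ((K : ℝ) ^ p) * φ (x - y) := setLIntegral_le_lintegral _ _
      _ = ENNReal.ofReal ((K : ℝ) ^ p) * I := by
          rw [lintegral_const_mul' _ _ ENNReal.ofReal_ne_top, lintegral_sub_left_eq_self]
  calc gagliardoEnergy s p Ω f ≤ ∫⁻ _ in Ω, ENNReal.ofReal ((K : ℝ) ^ p) * I :=
        setLIntegral_mono' hΩ.measurableSet hinner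
    _ = ENNReal.ofReal ((K : ℝ) ^ p) * I * volume Ω := setLIntegral_const _ _
    _ < ∞ := ENNReal.mul_lt_top (ENNReal.mul_lt_top ENNReal.ofReal_lt_top hIfin)
        hΩ.measure_lt_top

theorem memLp_of_continuousOn_isCompact {n m : ℕ} {Ω : Set (EuclideanSpace ℝ (Fin n))}
    (hΩ : IsCompact Ω) {f : EuclideanSpace ℝ (Fin n) → EuclideanSpace ℝ (Fin m)}
    (hf : ContinuousOn f Ω) (q : ℝ≥0∞) : MemLp f q (volume.restrict Ω) := by
  have : IsFiniteMeasure (volume.restrict Ω) := ⟨by simpa using hΩ.measure_lt_top⟩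
  obtain ⟨M, hM⟩ := hΩ.exists_bound_of_continuousOn hf
  exact MemLp.of_bound (hf.aestronglyMeasurable hΩ.measurableSet) M
    (ae_restrict_of_forall_mem hΩ.measurableSet hM)

/-! ### Acting on one coordinate at a time -/

section CoordMaps

variable {n : ℕ}

/-- A Lipschitz function of the coordinates `x j`, `j ≠ i`, equal to `1` where all of them are at
most `ρ` in absolute value, and to `0` where one of them is at least `1` in absolute value. -/
noncomputable def cutoff (ρ : ℝ) (i : Fin n) (x : EuclideanSpace ℝ (Fin n)) : ℝ :=
  max (1 - ∑ j ∈ Finset.univ.erase i, max (|x j| - ρ) 0 / (1 - ρ)) 0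

theorem cutoff_nonneg (ρ : ℝ) (i : Fin n) (x : EuclideanSpace ℝ (Fin n)) : 0 ≤ cutoff ρ i x :=
  le_max_right _ _

theorem cutoff_term_nonneg {ρ : ℝ} (hρ : ρ < 1) (x : EuclideanSpace ℝ (Fin n)) (j : Fin n) :
    0 ≤ max (|x j| - ρ) 0 / (1 - ρ) :=
  div_nonneg (le_max_right _ _) (sub_nonneg.2 hρ.le)

theorem cutoff_le_one {ρ : ℝ} (hρ : ρ < 1) (i : Fin n) (x : EuclideanSpace ℝ (Fin n)) :
    cutoff ρ i x ≤ 1 :=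
  max_le (sub_le_self _ (Finset.sum_nonneg fun j _ => cutoff_term_nonneg hρ x j)) zero_le_one

/-- Hence on each line in direction `i` the weight is constant, and `coordMap` reduces to a
one-variable interpolation. -/
theorem cutoff_congr (ρ : ℝ) {i : Fin n} {x y : EuclideanSpace ℝ (Fin n)}
    (h : ∀ j, j ≠ i → x j = y j) : cutoff ρ i x = cutoff ρ i y := by
  unfold cutoff
  rw [Finset.sum_congr rfl fun j hj => by rw [h j (Finset.ne_of_mem_erase hj)]]

theorem cutoff_eq_one {ρ : ℝ} {i : Fin n} {x : EuclideanSpace ℝ (Fin n)}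
    (h : ∀ j, |x j| ≤ ρ) : cutoff ρ i x = 1 := by
  unfold cutoff
  rw [Finset.sum_eq_zero fun j _ => by rw [max_eq_right (sub_nonpos.2 (h j)), zero_div]]
  norm_num

theorem cutoff_eq_zero {ρ : ℝ} (hρ : ρ < 1) {i j : Fin n} (hji : j ≠ i)
    {x : EuclideanSpace ℝ (Fin n)} (h : 1 ≤ |x j|) : cutoff ρ i x = 0 := by
  refine max_eq_right (sub_nonpos.2 ?_)
  refine le_trans ?_ (Finset.single_le_sum (fun k _ => cutoff_term_nonneg hρ x k)
    (Finset.mem_erase.2 ⟨hji, Finset.mem_univ j⟩))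
  rw [le_div_iff₀ (sub_pos.2 hρ), one_mul]
  exact le_max_of_le_left (by linarith)

theorem abs_coord_sub_le (x y : EuclideanSpace ℝ (Fin n)) (j : Fin n) : |x j - y j| ≤ ‖x - y‖ := by
  simpa using PiLp.norm_apply_le (x - y) j

theorem abs_cutoff_sub_le {ρ : ℝ} (hρ : ρ < 1) (i : Fin n) (x y : EuclideanSpace ℝ (Fin n)) :
    |cutoff ρ i x - cutoff ρ i y| ≤ n / (1 - ρ) * ‖x - y‖ := by
  have h1 : 0 < 1 - ρ := sub_pos.2 hρ
  refine (abs_max_sub_max_le_abs _ _ _).trans ?_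
  rw [sub_sub_sub_cancel_left, ← Finset.sum_sub_distrib]
  calc _ ≤ ∑ j ∈ Finset.univ.erase i, ‖x - y‖ / (1 - ρ) := by
        refine (Finset.abs_sum_le_sum_abs _ _).trans (Finset.sum_le_sum fun j _ => ?_)
        rw [← sub_div, abs_div, abs_of_pos h1]
        gcongr
        refine (abs_max_sub_max_le_abs _ _ _).trans ?_
        rw [sub_sub_sub_cancel_right]
        refine (abs_abs_sub_abs_le_abs_sub _ _).trans ?_
        rw [abs_sub_comm]
        exact abs_coord_sub_le x y j
    _ ≤ ∑ j : Fin n, ‖x - y‖ / (1 - ρ) :=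
        Finset.sum_le_sum_of_subset_of_nonneg (Finset.subset_univ _) fun _ _ _ => by positivity
    _ = n / (1 - ρ) * ‖x - y‖ := by simp; ring

/-- Apply `g` to the `i`-th coordinate, interpolating to the identity as another coordinate
approaches `±1`. -/
noncomputable def coordMap (g : ℝ → ℝ) (ρ : ℝ) (i : Fin n) (x : EuclideanSpace ℝ (Fin n)) :
    EuclideanSpace ℝ (Fin n) :=
  x + EuclideanSpace.single i (cutoff ρ i x * (g (x i) - x i))

theorem coordMap_apply_self (g : ℝ → ℝ) (ρ : ℝ) (i : Fin n) (x : EuclideanSpace ℝ (Fin n)) :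
    coordMap g ρ i x i = x i + cutoff ρ i x * (g (x i) - x i) := by
  simp [coordMap]

theorem coordMap_apply_of_ne (g : ℝ → ℝ) (ρ : ℝ) {i j : Fin n} (h : j ≠ i)
    (x : EuclideanSpace ℝ (Fin n)) : coordMap g ρ i x j = x j := by
  simp [coordMap, h]

theorem coordMap_eq_self {g : ℝ → ℝ} (hgn : g (-1) = -1) (hg : g 1 = 1) {ρ : ℝ} (hρ : ρ < 1)
    (i : Fin n) {x : EuclideanSpace ℝ (Fin n)} {j : Fin n} (hj : |x j| = 1) :
    coordMap g ρ i x = x := by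
  have : cutoff ρ i x * (g (x i) - x i) = 0 := by
    rcases eq_or_ne j i with rfl | hji
    · rcases eq_or_eq_neg_of_abs_eq hj with h | h <;> simp [h, hg, hgn]
    · rw [cutoff_eq_zero hρ hji hj.ge, zero_mul]
  ext k
  simp [coordMap, this]

/-- The map is the convex combination (1 - t) · id + t · g of increasing functions. -/
theorem strictMonoOn_interpolate {g : ℝ → ℝ} {S : Set ℝ} (hg : StrictMonoOn g S) {t : ℝ}
    (h0 : 0 ≤ t) (h1 : t ≤ 1) : StrictMonoOn (fun u => u + t * (g u - u)) S := by
  intro u hu v hv huv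
  have := hg hu hv huv
  simp only
  rcases h0.eq_or_lt with rfl | h0
  · simpa using huv
  · nlinarith [mul_pos h0 (sub_pos.2 this), mul_nonneg (sub_nonneg.2 h1) (sub_nonneg.2 huv.le)]

theorem bijOn_interpolate {g : ℝ → ℝ} (hg : StrictMonoOn g (Icc (-1) 1))
    (hc : ContinuousOn g (Icc (-1) 1)) (hgn : g (-1) = -1) (hg1 : g 1 = 1) {t : ℝ}
    (h0 : 0 ≤ t) (h1 : t ≤ 1) :
    BijOn (fun u => u + t * (g u - u)) (Icc (-1) 1) (Icc (-1) 1) := by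
  have hm := strictMonoOn_interpolate hg h0 h1
  have hcont : ContinuousOn (fun u => u + t * (g u - u)) (Icc (-1) 1) := by fun_prop
  have hl : (-1 : ℝ) ∈ Icc (-1 : ℝ) 1 := by norm_num
  have hr : (1 : ℝ) ∈ Icc (-1 : ℝ) 1 := by norm_num
  refine ⟨fun u hu => ⟨?_, ?_⟩, hm.injOn, ?_⟩
  · simpa [hgn] using hm.monotoneOn hl hu hu.1
  · simpa [hg1] using hm.monotoneOn hu hr hu.2
  · have h := intermediate_value_Icc (by norm_num : (-1 : ℝ) ≤ 1) hcont
    simp only [hgn, hg1, sub_self, mul_zero, add_zero] at h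
    exact h

theorem bijOn_coordMap {g : ℝ → ℝ} (hg : StrictMonoOn g (Icc (-1) 1))
    (hc : ContinuousOn g (Icc (-1) 1)) (hgn : g (-1) = -1) (hg1 : g 1 = 1) {ρ : ℝ} (hρ : ρ < 1)
    (i : Fin n) : BijOn (coordMap g ρ i) (closedCube n) (closedCube n) := by
  have hb (x : EuclideanSpace ℝ (Fin n)) :=
    bijOn_interpolate hg hc hgn hg1 (cutoff_nonneg ρ i x) (cutoff_le_one hρ i x)
  refine ⟨?_, ?_, ?_⟩
  · intro x hx j
    rcases eq_or_ne j i with rfl | hji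
    · rw [coordMap_apply_self]
      exact (hb x).mapsTo (hx j)
    · rw [coordMap_apply_of_ne g ρ hji]
      exact hx j
  · intro x hx y hy hxy
    have hoff : ∀ j, j ≠ i → x j = y j := fun j hj => by
      rw [← coordMap_apply_of_ne g ρ hj x, hxy, coordMap_apply_of_ne g ρ hj y]
    have hi : x i = y i := by
      have h : coordMap g ρ i x i = coordMap g ρ i y i := by rw [hxy]
      rw [coordMap_apply_self, coordMap_apply_self, ← cutoff_congr ρ hoff] at h
      exact (hb x).injOn (hx i) (hy i) h
    ext j
    rcases eq_or_ne j i with rfl | hji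
    · exact hi
    · exact hoff j hji
  · intro y hy
    obtain ⟨u, hu, huy⟩ := (hb y).surjOn (hy i)
    set x : EuclideanSpace ℝ (Fin n) := WithLp.toLp 2 (Function.update y.ofLp i u) with hx
    have hxi : x i = u := by simp [hx]
    have hxj : ∀ j, j ≠ i → x j = y j := fun j hj => by simp [hx, hj]
    refine ⟨x, fun j => ?_, ?_⟩
    · rcases eq_or_ne j i with rfl | hji
      · rwa [hxi]
      · rw [hxj j hji]
        exact hy j
    · ext j
      rcases eq_or_ne j i with rfl | hji
      · rw [coordMap_apply_self, cutoff_congr ρ hxj, hxi]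
        exact huy
      · rw [coordMap_apply_of_ne g ρ hji, hxj j hji]

theorem holderOnWith_of_norm_sub_le {E F : Type*} [SeminormedAddCommGroup E]
    [SeminormedAddCommGroup F] {f : E → F} {S : Set E} {K α : ℝ≥0}
    (h : ∀ x ∈ S, ∀ y ∈ S, ‖f x - f y‖ ≤ K * ‖x - y‖ ^ (α : ℝ)) : HolderOnWith K α f S := by
  intro x hx y hy
  rw [edist_dist, edist_dist, dist_eq_norm, dist_eq_norm,
    ENNReal.ofReal_rpow_of_nonneg (norm_nonneg _) α.coe_nonneg, ← ENNReal.ofReal_coe_nnreal,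
    ← ENNReal.ofReal_mul K.coe_nonneg]
  exact ENNReal.ofReal_le_ofReal (h x hx y hy)

theorem exists_holderOnWith_coordMap {g : ℝ → ℝ} (hgm : MapsTo g (Icc (-1) 1) (Icc (-1) 1))
    {K : ℝ} (hK : 0 ≤ K) {α : ℝ≥0} (hα : α ≤ 1)
    (hg : ∀ x ∈ Icc (-1 : ℝ) 1, ∀ y ∈ Icc (-1 : ℝ) 1, |g x - g y| ≤ K * |x - y| ^ (α : ℝ))
    {ρ : ℝ} (hρ : ρ < 1) (i : Fin n) :
    ∃ K' : ℝ≥0, HolderOnWith K' α (coordMap g ρ i) (closedCube n) := by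
  obtain ⟨D, hD0, hD⟩ := (isCompact_closedCube n).isBounded.exists_pos_norm_le
  have h1 : 0 < 1 - ρ := sub_pos.2 hρ
  have hα' : (α : ℝ) ≤ 1 := hα
  set L : ℝ := n / (1 - ρ) with hL
  have hL0 : 0 ≤ L := by positivity
  -- On the bounded cube, |x - y| ≤ B |x - y|^α, so Lipschitz terms are absorbed into the Hölder
  -- bound.
  set B : ℝ := (D + D) ^ (1 - (α : ℝ)) with hB
  refine ⟨NNReal.mk ((2 + 2 * L) * B + K) (by positivity), holderOnWith_of_norm_sub_le fun x hx y hy => ?_⟩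
  have hlin : ‖x - y‖ ≤ B * ‖x - y‖ ^ (α : ℝ) := by
    have hd : ‖x - y‖ ≤ D + D := (norm_sub_le _ _).trans (add_le_add (hD x hx) (hD y hy))
    rcases (norm_nonneg (x - y)).eq_or_lt with h | h
    · rw [← h]
      positivity
    · calc ‖x - y‖ = ‖x - y‖ ^ (1 - (α : ℝ)) * ‖x - y‖ ^ (α : ℝ) := by
            rw [← Real.rpow_add h, sub_add_cancel, Real.rpow_one]
        _ ≤ B * ‖x - y‖ ^ (α : ℝ) := by
            rw [hB]
            gcongr
  have hgi : |g (x i) - g (y i)| ≤ K * ‖x - y‖ ^ (α : ℝ) := by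
    refine (hg _ (hx i) _ (hy i)).trans ?_
    gcongr
    exact abs_coord_sub_le x y i
  have hxi := abs_coord_sub_le x y i
  have hbd : |g (y i) - y i| ≤ 2 := by
    have h2 := hgm (hy i)
    have h3 := hy i
    exact abs_le.2 ⟨by linarith [h2.1, h3.2], by linarith [h2.2, h3.1]⟩
  have hcut := abs_cutoff_sub_le hρ i x y
  have hdecomp : coordMap g ρ i x - coordMap g ρ i y = (x - y) + EuclideanSpace.single i
      (cutoff ρ i x * (g (x i) - x i) - cutoff ρ i y * (g (y i) - y i)) := by
    ext j
    rcases eq_or_ne j i with rfl | hji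
    · simp [coordMap]
      ring
    · simp [coordMap, hji]
  have hφ : |cutoff ρ i x * (g (x i) - x i) - cutoff ρ i y * (g (y i) - y i)| ≤
      (K * ‖x - y‖ ^ (α : ℝ) + ‖x - y‖) + L * ‖x - y‖ * 2 := by
    have e : cutoff ρ i x * (g (x i) - x i) - cutoff ρ i y * (g (y i) - y i) =
        cutoff ρ i x * ((g (x i) - g (y i)) - (x i - y i)) +
          (cutoff ρ i x - cutoff ρ i y) * (g (y i) - y i) := by ring
    rw [e]
    refine (abs_add_le _ _).trans (add_le_add ?_ ?_)
    · rw [abs_mul, abs_of_nonneg (cutoff_nonneg ρ i x)]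
      exact (mul_le_of_le_one_left (abs_nonneg _) (cutoff_le_one hρ i x)).trans
        ((abs_sub _ _).trans (add_le_add hgi hxi))
    · rw [abs_mul]
      exact mul_le_mul hcut hbd (abs_nonneg _) (by positivity)
  calc ‖coordMap g ρ i x - coordMap g ρ i y‖
      ≤ ‖x - y‖ + |cutoff ρ i x * (g (x i) - x i) - cutoff ρ i y * (g (y i) - y i)| := by
        rw [hdecomp]
        refine (norm_add_le _ _).trans ?_
        simp
    _ ≤ (2 + 2 * L) * ‖x - y‖ + K * ‖x - y‖ ^ (α : ℝ) := by linarith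
    _ ≤ (2 + 2 * L) * (B * ‖x - y‖ ^ (α : ℝ)) + K * ‖x - y‖ ^ (α : ℝ) := by gcongr
    _ = ((2 + 2 * L) * B + K) * ‖x - y‖ ^ (α : ℝ) := by ring

/-- The composition of the maps `coordMap g ρ i` over the list `l`. -/
noncomputable def coordMaps (g : ℝ → ℝ) (ρ : ℝ) :
    List (Fin n) → EuclideanSpace ℝ (Fin n) → EuclideanSpace ℝ (Fin n)
  | [] => id
  | i :: l => coordMap g ρ i ∘ coordMaps g ρ l

theorem bijOn_coordMaps {g : ℝ → ℝ} (hg : StrictMonoOn g (Icc (-1) 1))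
    (hc : ContinuousOn g (Icc (-1) 1)) (hgn : g (-1) = -1) (hg1 : g 1 = 1) {ρ : ℝ} (hρ : ρ < 1)
    (l : List (Fin n)) : BijOn (coordMaps g ρ l) (closedCube n) (closedCube n) := by
  induction l with
  | nil => exact bijOn_id _
  | cons i l ih => exact (bijOn_coordMap hg hc hgn hg1 hρ i).comp ih

theorem coordMaps_eq_self {g : ℝ → ℝ} (hgn : g (-1) = -1) (hg : g 1 = 1) {ρ : ℝ} (hρ : ρ < 1)
    (l : List (Fin n)) {x : EuclideanSpace ℝ (Fin n)} {j : Fin n} (hj : |x j| = 1) :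
    coordMaps g ρ l x = x := by
  induction l with
  | nil => rfl
  | cons i l ih => rw [coordMaps, Function.comp_apply, ih, coordMap_eq_self hgn hg hρ i hj]

theorem exists_holderOnWith_coordMaps {g : ℝ → ℝ} (hgs : StrictMonoOn g (Icc (-1) 1))
    (hc : ContinuousOn g (Icc (-1) 1)) (hgn : g (-1) = -1) (hg1 : g 1 = 1)
    {K : ℝ} (hK : 0 ≤ K) {α : ℝ≥0} (hα : α ≤ 1)
    (hg : ∀ x ∈ Icc (-1 : ℝ) 1, ∀ y ∈ Icc (-1 : ℝ) 1, |g x - g y| ≤ K * |x - y| ^ (α : ℝ))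
    {ρ : ℝ} (hρ : ρ < 1) (l : List (Fin n)) :
    ∃ K' : ℝ≥0, HolderOnWith K' (α ^ l.length) (coordMaps g ρ l) (closedCube n) := by
  have hgm : MapsTo g (Icc (-1) 1) (Icc (-1) 1) := by
    -- At t = 1 the interpolation is g itself.
    simpa using (bijOn_interpolate hgs hc hgn hg1 zero_le_one le_rfl).mapsTo
  induction l with
  | nil =>
    refine ⟨1, ?_⟩
    rw [List.length_nil, pow_zero]
    exact holderWith_id.holderOnWith _
  | cons i l ih =>
    obtain ⟨K₁, h₁⟩ := ih
    obtain ⟨K₂, h₂⟩ := exists_holderOnWith_coordMap hgm hK hα hg hρ i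
    rw [List.length_cons, pow_succ']
    exact ⟨_, h₂.comp h₁ (bijOn_coordMaps hgs hc hgn hg1 hρ l).mapsTo⟩

/-- At every stage each coordinate is either x j or g (x j), so it stays within ρ and every cutoff
equals 1. Without repetitions in `l`, no coordinate receives g twice. -/
theorem coordMaps_apply {g : ℝ → ℝ} {ρ : ℝ} {l : List (Fin n)} (hl : l.Nodup)
    {x : EuclideanSpace ℝ (Fin n)} (hx : ∀ j, |x j| ≤ ρ) (hgx : ∀ j, |g (x j)| ≤ ρ) (j : Fin n) :
    coordMaps g ρ l x j = if j ∈ l then g (x j) else x j := by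
  induction l generalizing j with
  | nil => rfl
  | cons i l ih =>
    obtain ⟨hil, hl⟩ := List.nodup_cons.1 hl
    have ih := ih hl
    have hy : ∀ j, |coordMaps g ρ l x j| ≤ ρ := fun j => by
      rw [ih j]
      split_ifs
      · exact hgx j
      · exact hx j
    rw [coordMaps, Function.comp_apply]
    rcases eq_or_ne j i with rfl | hji
    · rw [coordMap_apply_self, cutoff_eq_one hy, ih j, if_neg hil, if_pos List.mem_cons_self]
      ring
    · rw [coordMap_apply_of_ne g ρ hji, ih j]
      simp [hji]

theorem image_coordMaps_euclideanPower {g : ℝ → ℝ} {ρ : ℝ} {A : Set ℝ}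
    (hA : ∀ u ∈ A, |u| ≤ ρ) (hgA : ∀ u ∈ A, |g u| ≤ ρ) :
    coordMaps g ρ (List.finRange n) '' euclideanPower n A = euclideanPower n (g '' A) := by
  have happ : ∀ x ∈ euclideanPower n A, ∀ j,
      coordMaps g ρ (List.finRange n) x j = g (x j) := fun x hx j => by
    rw [coordMaps_apply (List.nodup_finRange n) (fun j => hA _ (hx j)) (fun j => hgA _ (hx j)),
      if_pos (List.mem_finRange j)]
  ext y
  constructor
  · rintro ⟨x, hx, rfl⟩ j
    rw [happ x hx]
    exact mem_image_of_mem g (hx j)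
  · intro hy
    choose u hu hgu using hy
    refine ⟨WithLp.toLp 2 u, hu, ?_⟩
    ext j
    rw [happ _ hu]
    exact hgu j

theorem exists_abs_le_lt_one {A : Set ℝ} (hA : IsCompact A) (h : A ⊆ Ioo (-1) 1) :
    ∃ ρ < 1, ∀ u ∈ A, |u| ≤ ρ := by
  rcases A.eq_empty_or_nonempty with rfl | hne
  · exact ⟨0, zero_lt_one, by simp⟩
  · obtain ⟨u, hu, hmax⟩ := hA.exists_isMaxOn hne continuous_abs.continuousOn
    exact ⟨|u|, abs_lt.2 (h hu), fun v hv => hmax hv⟩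

end CoordMaps

/-! ### Assembling the homeomorphism -/

theorem theorem1p2 (n : ℕ) (hn : 2 ≤ n) (s : ℝ) (hs0 : 0 < s) (hs1 : s < 1)
    (p : ℝ) (hp : 1 < p) :
    ∃ f : EuclideanSpace ℝ (Fin n) → EuclideanSpace ℝ (Fin n),
      IsHomeoOn f (closedCube n) (closedCube n) ∧
      MemFracSobolev s p (closedCube n) f ∧
      (∀ x ∈ frontier (closedCube n), f x = x) ∧
      ¬ LusinN f (openCube n) ∧
      (∃ α : ℝ≥0, s < α ∧ α < 1 ∧ ∃ K : ℝ≥0, HolderOnWith K α f (closedCube n)) ∧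
      (∃ C ⊆ openCube n, IsCantorSet C ∧ volume C = 0 ∧
        IsCantorSet (f '' C) ∧ 0 < volume (f '' C)) := by
  have hn0 : n ≠ 0 := by omega
  obtain ⟨r, hsr, hr1⟩ := exists_between hs1
  have hr0 : 0 < r := hs0.trans hsr
  -- Each of the n factors is `a`-Hölder and exponents multiply under composition, so the n-th root
  -- of r yields exponent r > s.
  set a : ℝ≥0 := NNReal.mk (r ^ (n : ℝ)⁻¹) (by positivity) with ha
  have han : ((a ^ n : ℝ≥0) : ℝ) = r := by
    rw [NNReal.coe_pow, ha, NNReal.coe_mk, Real.rpow_inv_natCast_pow hr0.le hn0]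
  have ha0 : 0 < (a : ℝ) := by rw [ha, NNReal.coe_mk]; positivity
  have ha1 : (a : ℝ) < 1 := by
    rw [ha, NNReal.coe_mk]
    exact Real.rpow_lt_one hr0.le hr1 (by positivity)
  obtain ⟨g, hgs, hgn, hg1, ⟨K, hK, hgK⟩, A, hAsub, hAc, hA0, hgA⟩ :=
    exists_strictMonoOn_holder_volume_image_pos ha0 ha1
  have hAI : A ⊆ Icc (-1) 1 := hAsub.trans Ioo_subset_Icc_self
  have hgc : ContinuousOn g (Icc (-1) 1) :=
    (holderOnWith_of_norm_sub_le (K := NNReal.mk K hK) hgK).continuousOn ha0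
  have hgAc : IsCompact (g '' A) := hAc.image_of_continuousOn (hgc.mono hAI)
  have hgAsub : g '' A ⊆ Ioo (-1) 1 := by
    rintro _ ⟨u, hu, rfl⟩
    have h1 := hgs (by norm_num) (hAI hu) (hAsub hu).1
    have h2 := hgs (hAI hu) (by norm_num) (hAsub hu).2
    rw [hgn] at h1
    rw [hg1] at h2
    exact ⟨h1, h2⟩
  -- The bound must cover g(A) as well as A, since later factors see coordinates already moved by g.
  obtain ⟨ρ, hρ, hbd⟩ := exists_abs_le_lt_one (hAc.union hgAc) (union_subset hAsub hgAsub)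
  set f : EuclideanSpace ℝ (Fin n) → EuclideanSpace ℝ (Fin n) :=
    coordMaps g ρ (List.finRange n) with hf
  have hbij : BijOn f (closedCube n) (closedCube n) := bijOn_coordMaps hgs hgc hgn hg1 hρ _
  obtain ⟨K', hK'⟩ := exists_holderOnWith_coordMaps hgs hgc hgn hg1 hK ha1.le hgK hρ
    (List.finRange n)
  rw [List.length_finRange] at hK'
  have hfc : ContinuousOn f (closedCube n) := hK'.continuousOn (pow_pos ha0 n)
  have himg : f '' euclideanPower n A = euclideanPower n (g '' A) :=
    image_coordMaps_euclideanPower (fun u hu => hbd u (Or.inl hu))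
      (fun u hu => hbd _ (Or.inr (mem_image_of_mem g hu)))
  have hpos : 0 < volume (f '' euclideanPower n A) := by
    rw [himg, volume_euclideanPower n hgAc.measurableSet]
    exact ENNReal.pow_pos hgA n
  obtain ⟨C, hCA, hC, hCpos⟩ := exists_isCantorSet_subset hn0 (isCompact_euclideanPower n hAc)
    (isTotallyDisconnected_euclideanPower n (isTotallyDisconnected_of_volume_eq_zero hA0)) hpos
  have hCo : C ⊆ openCube n := fun x hx i => hAsub (hCA hx i)
  have hCc : C ⊆ closedCube n := fun x hx i => hAI (hCA hx i)
  have hC0 : volume C = 0 := by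
    refine measure_mono_null hCA ?_
    rw [volume_euclideanPower n hAc.measurableSet, hA0, zero_pow hn0]
  refine ⟨f, isHomeoOn_of_bijOn (isCompact_closedCube n) hfc hbij,
    ⟨memLp_of_continuousOn_isCompact (isCompact_closedCube n) hfc _,
      gagliardoEnergy_lt_top_of_holderOnWith hn0 (by linarith) (isCompact_closedCube n)
        (by rw [han]; exact hsr) hK'⟩,
    fun x hx => ?_, fun hN => hCpos.ne' (hN C hCo hC0),
    ⟨a ^ n, by rw [han]; exact hsr, by rw [← NNReal.coe_lt_coe, han]; exact hr1, K', hK'⟩,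
    C, hCo, hC, hC0, hC.image (hfc.mono hCc) (hbij.injOn.mono hCc), hCpos⟩
  obtain ⟨j, hj⟩ := exists_abs_eq_one_of_mem_frontier hx
  exact coordMaps_eq_self hgn hg1 hρ _ hj
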